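/- Let $n\ge 0$ and $t\ge 1$ be integers, let $\delta$ be a real number, and let $\mathcal U$ be a (Borel) probability distribution over the unitary group $U(2^n)$, acting on the space of $n$ qubits with computational basis $\{|z\rangle : z\in\{0,1\}^n\}$. Suppose that $\mathcal U$ is a $\delta$-approximate unitary $t$-design in the relative-error sense, that is, \[ (1-\delta)\,\mathbb E_{U\sim \mathrm{Haar}}\big[(U\cdot U^\dagger)^{\otimes t}\big]\;\preceq\;\mathbb E_{U\sim\mathcal U}\big[(U\cdot U^\dagger)^{\otimes t}\big]\;\preceq\;(1+\delta)\,\mathbb E_{U\sim \mathrm{Haar}}\big[(U\cdot U^\dagger)^{\otimes t}\big], \] where $\mathrm{Haar}$ is the Haar probability measure on $U(2^n)$, $(U\cdot U^\dagger)^{\otimes t}$ denotes the superoperator $X\mapsto U^{\otimes t}X(U^{\otimes t})^\dagger$, and $A\preceq B$ means that $B-A$ is a completely positive map. Let $g:U(2^n)\to\{0,1\}^n$ be a ($\mathcal U$-almost everywhere) measurable function and put \[ M(g;\mathcal U):=\mathbb E_{U\sim\mathcal U}\big[U^\dagger|g(U)\rangle\langle g(U)|U\big]. \] Then, for the operator norm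 $\|M\|_{op}=\sup_{v\neq 0}\|Mv\|_2/\|v\|_2$, \[ \|M(g;\mathcal U)\|_{op}\;\le\;\left(\frac{(1+\delta)\,t!}{(2^n+1)(2^n+2)\cdots(2^n+t-1)}\right)^{1/t}\;\le\;\frac{\delta+t}{2^{n(t-1)/t}}, \] where the product in the denominator is empty, equal to $1$, when $t=1$. -/

import Mathlib

open scoped Matrix Matrix.Norms.L2Operator MatrixOrder CStarAlgebra

/-- The unitary group `U(N)`, as a set of `N × N` complex matrices indexed by `ι`, carries its Borel
σ-algebra. -/
noncomputable instance unitaryMeasurableSpace {ι : Type*} [Fintype ι] [DecidableEq ι] :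
    MeasurableSpace (Matrix.unitaryGroup ι ℂ) := borel _

instance unitaryBorelSpace {ι : Type*} [Fintype ι] [DecidableEq ι] :
    BorelSpace (Matrix.unitaryGroup ι ℂ) := ⟨rfl⟩

instance unitaryCompactSpace {ι : Type*} [Fintype ι] [DecidableEq ι] :
    CompactSpace (Matrix.unitaryGroup ι ℂ) := by
  have hproper : ProperSpace (Matrix ι ι ℂ) := FiniteDimensional.proper ℂ _
  apply isCompact_iff_compactSpace.mp
  refine Metric.isCompact_of_isClosed_isBounded isClosed_unitary ?_
  refine Metric.isBounded_iff_subset_closedBall (0 : Matrix ι ι ℂ) |>.mpr ⟨1, fun U hU => ?_⟩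
  rw [mem_closedBall_zero_iff]
  have h := CStarRing.norm_star_mul_self (x := U)
  rw [(Unitary.mem_iff.mp hU).1] at h
  have h1 : ‖(1 : Matrix ι ι ℂ)‖ ≤ 1 := by
    rw [Matrix.cstar_norm_def, map_one]
    exact ContinuousLinearMap.norm_id_le
  nlinarith [norm_nonneg U]

/-- The Haar probability measure on the (compact) unitary group. -/
noncomputable def unitaryHaar (ι : Type*) [Fintype ι] [DecidableEq ι] :
    MeasureTheory.Measure (Matrix.unitaryGroup ι ℂ) :=
  MeasureTheory.Measure.haarMeasure ⊤

instance unitaryHaarProbability {ι : Type*} [Fintype ι] [DecidableEq ι] :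
    MeasureTheory.IsProbabilityMeasure (unitaryHaar ι) := by
  have h := MeasureTheory.Measure.haarMeasure_self
    (K₀ := (⊤ : TopologicalSpace.PositiveCompacts (Matrix.unitaryGroup ι ℂ)))
  exact ⟨by simpa [unitaryHaar] using h⟩

/-- The `t`-fold tensor power `A^{⊗ t}` of a matrix `A` on `(ℂ^ι)^{⊗ t} ≅ ℂ^(ι^t)`. -/
def tensorPower {ι : Type*} (t : ℕ) (A : Matrix ι ι ℂ) :
    Matrix (Fin t → ι) (Fin t → ι) ℂ :=
  Matrix.of fun i j => ∏ k, A (i k) (j k)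

theorem continuous_tensorPower_conj {ι : Type*} [Fintype ι] [DecidableEq ι] (t : ℕ)
    (X : Matrix (Fin t → ι) (Fin t → ι) ℂ) :
    Continuous fun U : Matrix.unitaryGroup ι ℂ =>
      tensorPower t (U : Matrix ι ι ℂ) * X * (tensorPower t (U : Matrix ι ι ℂ))ᴴ := by
  have h : Continuous fun U : Matrix.unitaryGroup ι ℂ => tensorPower t (U : Matrix ι ι ℂ) := by
    refine continuous_matrix fun i j => ?_
    simp only [tensorPower, Matrix.of_apply]
    exact continuous_finsetProd _ fun k _ => continuous_subtype_val.matrix_elem _ _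
  exact (h.matrix_mul continuous_const).matrix_mul h.matrix_conjTranspose

theorem integrable_tensorPower_conj {ι : Type*} [Fintype ι] [DecidableEq ι] (t : ℕ)
    (μ : MeasureTheory.Measure (Matrix.unitaryGroup ι ℂ)) [MeasureTheory.IsFiniteMeasure μ]
    (X : Matrix (Fin t → ι) (Fin t → ι) ℂ) :
    MeasureTheory.Integrable (fun U : Matrix.unitaryGroup ι ℂ =>
      tensorPower t (U : Matrix ι ι ℂ) * X * (tensorPower t (U : Matrix ι ι ℂ))ᴴ) μ :=
  (continuous_tensorPower_conj t X).integrable_of_hasCompactSupport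
    (HasCompactSupport.of_compactSpace _)

/-- The `t`-th moment superoperator `E_{U ∼ μ} [(U · U†)^{⊗ t}]`, that is,
`X ↦ E_{U ∼ μ} [U^{⊗ t} X (U^{⊗ t})†]`. -/
noncomputable def momentOperator {ι : Type*} [Fintype ι] [DecidableEq ι] (t : ℕ)
    (μ : MeasureTheory.Measure (Matrix.unitaryGroup ι ℂ)) [MeasureTheory.IsFiniteMeasure μ] :
    Matrix (Fin t → ι) (Fin t → ι) ℂ →ₗ[ℂ] Matrix (Fin t → ι) (Fin t → ι) ℂ where
  toFun X := ∫ U : Matrix.unitaryGroup ι ℂ,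
    tensorPower t (U : Matrix ι ι ℂ) * X * (tensorPower t (U : Matrix ι ι ℂ))ᴴ ∂μ
  map_add' X Y := by
    rw [← MeasureTheory.integral_add (integrable_tensorPower_conj t μ X)
      (integrable_tensorPower_conj t μ Y)]
    simp only [mul_add, add_mul]
  map_smul' c X := by
    rw [RingHom.id_apply, ← MeasureTheory.integral_smul]
    simp only [Matrix.mul_smul, Matrix.smul_mul]

/-- `A ⪯ B` for superoperators: `B - A` is a completely positive map. -/
def CPLE {κ : Type*} [Fintype κ] [DecidableEq κ]
    (A B : Matrix κ κ ℂ →ₗ[ℂ] Matrix κ κ ℂ) : Prop :=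
  ∃ Φ : Matrix κ κ ℂ →CP Matrix κ κ ℂ, Φ.toLinearMap = B - A

/-- A distribution `μ` on the unitary group is a `δ`-approximate unitary `t`-design, in the
multiplicative (relative-error) sense. -/
def IsApproxUnitaryDesign {ι : Type*} [Fintype ι] [DecidableEq ι] (δ : ℝ) (t : ℕ)
    (μ : MeasureTheory.Measure (Matrix.unitaryGroup ι ℂ)) [MeasureTheory.IsProbabilityMeasure μ] :
    Prop :=
  CPLE ((1 - δ) • momentOperator t (unitaryHaar ι)) (momentOperator t μ) ∧
    CPLE (momentOperator t μ) ((1 + δ) • momentOperator t (unitaryHaar ι))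

/-- `M(g; μ) = E_{U ∼ μ} [U† |g(U)⟩⟨g(U)| U]`. The computational basis of `n` qubits is indexed by
the bit strings `Fin n → Bool`, and `Matrix.single z z 1` is the projector `|z⟩⟨z|`. -/
noncomputable def measurementMatrix {n : ℕ}
    (g : Matrix.unitaryGroup (Fin n → Bool) ℂ → (Fin n → Bool))
    (μ : MeasureTheory.Measure (Matrix.unitaryGroup (Fin n → Bool) ℂ)) :
    Matrix (Fin n → Bool) (Fin n → Bool) ℂ :=
  ∫ U, (U : Matrix (Fin n → Bool) (Fin n → Bool) ℂ)ᴴ * Matrix.single (g U) (g U) 1 *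
    (U : Matrix (Fin n → Bool) (Fin n → Bool) ℂ) ∂μ

/-!
For a unit vector `v`, the quadratic form of `M(g; μ)` at `v` is the `μ`-average of
`|(U v)_{g(U)}| ^ 2`. By Jensen's inequality its `t`-th power is at most the average of
`|(U v)_{g(U)}| ^ (2t)`, hence at most `∑ z, E |(U v)_z| ^ (2t)`, where `g` no longer appears
(`integral_norm_sq_select_pow_le`). Each summand is a diagonal entry of the `t`-th moment operator
at the positive matrix `(|v⟩⟨v|)^{⊗ t}`, so the design property replaces `μ` by Haar measure at the
cost of a factor `1 + δ` (`IsApproxUnitaryDesign.integral_norm_pow_le`). As the form of `M(g; μ)` is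
an average of products `conj (U w)_{g(U)} * (U v)_{g(U)}`, AM-GM bounds it at unit vectors by the
quadratic form, which therefore controls the operator norm
(`norm_toEuclideanCLM_measurementMatrix_le`).

The Haar moments `m_t = E |(U v)_a| ^ (2t) = t! / (N (N + 1) ⋯ (N + t - 1))`, with `N` the dimension,
are computed without representation theory (`prod_mul_integral_unitaryHaar_norm_pow`). By left
invariance, `E |x_a + s x_b| ^ (2t) = (1 + s²) ^ t m_t` for `x = U v` and real `s`; invariance under
diagonal phases removes the off-diagonal terms of the expansion of the left-hand side, and the
coefficients of `s²` give `t E |x_a| ^ (2(t-1)) |x_b| ^ 2 = m_t` for `a ≠ b`. Summing over `b`, with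
`∑ b, |x_b| ^ 2 = 1`, yields the recursion `t m_{t-1} = (N + t - 1) m_t`.
-/

/-! ### Orbits of a vector under Haar-random unitaries -/

instance unitaryHaar_isMulLeftInvariant {ι : Type*} [Fintype ι] [DecidableEq ι] :
    (unitaryHaar ι).IsMulLeftInvariant := by
  unfold unitaryHaar
  infer_instance

theorem continuous_unitary_mulVec {ι : Type*} [Fintype ι] [DecidableEq ι] (v : ι → ℂ) :
    Continuous fun U : Matrix.unitaryGroup ι ℂ => (U : Matrix ι ι ℂ) *ᵥ v :=
  Continuous.matrix_mulVec continuous_subtype_val continuous_const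

theorem continuous_unitary_mulVec_apply {ι : Type*} [Fintype ι] [DecidableEq ι] (v : ι → ℂ)
    (a : ι) : Continuous fun U : Matrix.unitaryGroup ι ℂ => ((U : Matrix ι ι ℂ) *ᵥ v) a :=
  (continuous_apply a).comp (continuous_unitary_mulVec v)

theorem Continuous.integrable_unitaryGroup {ι E : Type*} [Fintype ι] [DecidableEq ι]
    [NormedAddCommGroup E] {μ : MeasureTheory.Measure (Matrix.unitaryGroup ι ℂ)}
    [MeasureTheory.IsFiniteMeasure μ] {f : Matrix.unitaryGroup ι ℂ → E} (hf : Continuous f) :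
    MeasureTheory.Integrable f μ :=
  hf.integrable_of_hasCompactSupport (HasCompactSupport.of_compactSpace _)

theorem integral_unitaryHaar_mulVec {ι E : Type*} [Fintype ι] [DecidableEq ι]
    [NormedAddCommGroup E] [NormedSpace ℝ E] (v : ι → ℂ) (W : Matrix.unitaryGroup ι ℂ)
    (h : (ι → ℂ) → E) :
    ∫ U : Matrix.unitaryGroup ι ℂ, h ((W : Matrix ι ι ℂ) *ᵥ ((U : Matrix ι ι ℂ) *ᵥ v))
        ∂unitaryHaar ι =
      ∫ U : Matrix.unitaryGroup ι ℂ, h ((U : Matrix ι ι ℂ) *ᵥ v) ∂unitaryHaar ι := by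
  rw [← MeasureTheory.integral_mul_left_eq_self
    (fun U : Matrix.unitaryGroup ι ℂ => h ((U : Matrix ι ι ℂ) *ᵥ v)) W]
  simp [Matrix.mulVec_mulVec]

theorem sum_norm_sq_unitary_mulVec {ι : Type*} [Fintype ι] [DecidableEq ι]
    (U : Matrix.unitaryGroup ι ℂ) (v : ι → ℂ) :
    ∑ i, ‖((U : Matrix ι ι ℂ) *ᵥ v) i‖ ^ 2 = ∑ i, ‖v i‖ ^ 2 := by
  have key : ∀ w : ι → ℂ, ((∑ i, ‖w i‖ ^ 2 : ℝ) : ℂ) = star w ⬝ᵥ w := fun w => by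
    simp [dotProduct, ← Complex.conj_mul']
  apply Complex.ofReal_injective
  rw [key, key, Matrix.star_mulVec, Matrix.dotProduct_mulVec, Matrix.vecMul_vecMul,
    ← Matrix.star_eq_conjTranspose, Matrix.UnitaryGroup.star_mul_self, Matrix.vecMul_one]

/-- Every unit vector is a row of some unitary matrix, at any prescribed position. -/
theorem exists_unitary_mulVec_apply_eq {ι : Type*} [Fintype ι] [DecidableEq ι] (a : ι)
    (w : ι → ℂ) (hw : ∑ i, ‖w i‖ ^ 2 = 1) :
    ∃ W : Matrix.unitaryGroup ι ℂ, ∀ x, ((W : Matrix ι ι ℂ) *ᵥ x) a = w ⬝ᵥ x := by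
  let e : ι → EuclideanSpace ℂ ι := fun _ => WithLp.toLp 2 (star w)
  have he : Orthonormal ℂ (({a} : Set ι).domRestrict e) := by
    refine ⟨fun i => ?_, fun i j hij => (hij (Subsingleton.elim i j)).elim⟩
    change ‖e i‖ = 1
    simp [e, EuclideanSpace.norm_eq, hw]
  obtain ⟨b, hb⟩ := he.exists_orthonormalBasis_extension_of_card_eq (by simp)
  refine ⟨⟨Matrix.of fun i j => star (b i j), ?_⟩, fun x => ?_⟩
  · rw [Matrix.mem_unitaryGroup_iff]
    ext i k
    have h := orthonormal_iff_ite.mp b.orthonormal i k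
    rw [PiLp.inner_apply] at h
    rw [Matrix.mul_apply, Matrix.one_apply, ← h]
    refine Finset.sum_congr rfl fun j _ => ?_
    simp [mul_comm]
  · have h := hb a rfl
    simp only [Matrix.mulVec, dotProduct, Matrix.of_apply, h, e]
    simp

/-- The law of `U v` under Haar measure is invariant under unitaries, so the moments of its
coordinate along a vector depend only on the length of that vector. -/
theorem integral_unitaryHaar_norm_dotProduct_pow {ι : Type*} [Fintype ι] [DecidableEq ι]
    (v : ι → ℂ) (a : ι) (w : ι → ℂ) (t : ℕ) :
    ∫ U : Matrix.unitaryGroup ι ℂ, ‖w ⬝ᵥ ((U : Matrix ι ι ℂ) *ᵥ v)‖ ^ (2 * t) ∂unitaryHaar ι =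
      (∑ i, ‖w i‖ ^ 2) ^ t *
        ∫ U : Matrix.unitaryGroup ι ℂ, ‖((U : Matrix ι ι ℂ) *ᵥ v) a‖ ^ (2 * t) ∂unitaryHaar ι := by
  set r : ℝ := ∑ i, ‖w i‖ ^ 2 with hr
  have hr0 : 0 ≤ r := Finset.sum_nonneg fun i _ => by positivity
  rcases hr0.eq_or_lt with h0 | hpos
  · have hw : w = 0 := by
      funext i
      have := (Finset.sum_eq_zero_iff_of_nonneg fun i _ => by positivity).mp
        (hr.symm.trans h0.symm) i (Finset.mem_univ i)
      simpa using this
    rcases t.eq_zero_or_pos with rfl | ht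
    · simp
    · simp [hw, ← h0, ht.ne']
  · have hs : √r ≠ 0 := (Real.sqrt_pos.mpr hpos).ne'
    -- move the direction `w / ‖w‖` to the coordinate `a`
    obtain ⟨W, hW⟩ := exists_unitary_mulVec_apply_eq a (((√r)⁻¹ : ℂ) • w) (by
      simp only [Pi.smul_apply, norm_smul, mul_pow, ← Finset.mul_sum, ← hr]
      simp [Real.sq_sqrt hr0, hpos.ne'])
    rw [← integral_unitaryHaar_mulVec v W fun x => ‖x a‖ ^ (2 * t),
      ← MeasureTheory.integral_const_mul]
    refine MeasureTheory.integral_congr_ae (.of_forall fun U => ?_)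
    simp only [hW, smul_dotProduct, norm_smul, mul_pow]
    simp only [norm_inv, Complex.norm_real, Real.norm_eq_abs, abs_of_nonneg (Real.sqrt_nonneg r),
      pow_mul, inv_pow, Real.sq_sqrt hr0]
    field_simp

/-- Monomials in two distinct coordinates of `U v` with unequal holomorphic and antiholomorphic
degrees in one of them average to zero, by invariance under a phase on that coordinate. -/
theorem integral_unitaryHaar_monomial_eq_zero {ι : Type*} [Fintype ι] [DecidableEq ι]
    (v : ι → ℂ) {a b : ι} (hab : a ≠ b) (p q : ℕ) {j k : ℕ} (hjk : j ≠ k) :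
    ∫ U : Matrix.unitaryGroup ι ℂ, ((U : Matrix ι ι ℂ) *ᵥ v) a ^ p *
        ((U : Matrix ι ι ℂ) *ᵥ v) b ^ j * star (((U : Matrix ι ι ℂ) *ᵥ v) a) ^ q *
        star (((U : Matrix ι ι ℂ) *ᵥ v) b) ^ k ∂unitaryHaar ι = 0 := by
  obtain ⟨ζ, hζ, hζ1⟩ : ∃ ζ : ℂ, ‖ζ‖ = 1 ∧ ζ ^ j * star ζ ^ k = -1 := by
    -- the phase of angle `π / (j - k)`
    have hd : ((j : ℂ) - k) ≠ 0 := sub_ne_zero.mpr (by exact_mod_cast hjk)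
    refine ⟨Complex.exp ((Real.pi / ((j : ℝ) - k) : ℝ) * Complex.I),
      Complex.norm_exp_ofReal_mul_I _, ?_⟩
    rw [Complex.star_def, ← Complex.exp_conj, ← Complex.exp_nat_mul, ← Complex.exp_nat_mul,
      ← Complex.exp_add, ← Complex.exp_pi_mul_I]
    congr 1
    simp only [map_mul, Complex.conj_ofReal, Complex.conj_I]
    push_cast
    field_simp
    ring
  have hW : Matrix.diagonal (Function.update (1 : ι → ℂ) b ζ) ∈ Matrix.unitaryGroup ι ℂ := by
    rw [Matrix.mem_unitaryGroup_iff, Matrix.star_eq_conjTranspose, Matrix.diagonal_conjTranspose,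
      Matrix.diagonal_mul_diagonal, ← Matrix.diagonal_one]
    congr 1
    funext i
    by_cases hi : i = b
    · subst hi
      simp [Complex.mul_conj', hζ]
    · simp [Function.update_of_ne hi]
  have h := integral_unitaryHaar_mulVec v ⟨_, hW⟩ fun x =>
    x a ^ p * x b ^ j * star (x a) ^ q * star (x b) ^ k
  simp only [Matrix.mulVec_diagonal, Function.update_self, Function.update_of_ne hab,
    Pi.one_apply, one_mul, star_mul', mul_pow] at h
  have h2 : ∀ x y : ℂ, x ^ p * (ζ ^ j * y ^ j) * star x ^ q * (star ζ ^ k * star y ^ k) =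
      (-1) * (x ^ p * y ^ j * star x ^ q * star y ^ k) := fun x y => by
    rw [← hζ1]; ring
  simp only [h2] at h
  rw [MeasureTheory.integral_const_mul] at h
  linear_combination (-1 / 2 : ℂ) * h

/-! ### Haar moments of a coordinate -/

/-- Averaging `|x_a + s x_b| ^ (2t)` over Haar measure kills the off-diagonal terms of the double
binomial expansion. -/
theorem integral_unitaryHaar_norm_add_pow {ι : Type*} [Fintype ι] [DecidableEq ι]
    (v : ι → ℂ) {a b : ι} (hab : a ≠ b) (t : ℕ) (s : ℝ) :
    ∫ U : Matrix.unitaryGroup ι ℂ, ‖((U : Matrix ι ι ℂ) *ᵥ v) a +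
        s * ((U : Matrix ι ι ℂ) *ᵥ v) b‖ ^ (2 * t) ∂unitaryHaar ι =
      ∑ j ∈ Finset.range (t + 1), (t.choose j : ℝ) ^ 2 * (s ^ 2) ^ j *
        ∫ U : Matrix.unitaryGroup ι ℂ, ‖((U : Matrix ι ι ℂ) *ᵥ v) a‖ ^ (2 * (t - j)) *
          ‖((U : Matrix ι ι ℂ) *ᵥ v) b‖ ^ (2 * j) ∂unitaryHaar ι := by
  have hexp : ∀ x y : ℂ, ((‖x + s * y‖ ^ (2 * t) : ℝ) : ℂ) =
      ∑ j ∈ Finset.range (t + 1), ∑ k ∈ Finset.range (t + 1),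
        ((t.choose j : ℂ) * t.choose k * s ^ j * s ^ k) *
          (x ^ (t - j) * y ^ j * star x ^ (t - k) * star y ^ k) := fun x y => by
    have h1 : ((‖x + s * y‖ ^ (2 * t) : ℝ) : ℂ) =
        (s * y + x) ^ t * (s * star y + star x) ^ t := by
      rw [pow_mul]
      push_cast
      rw [← Complex.mul_conj', mul_pow]
      simp [add_comm]
    rw [h1, add_pow, add_pow, Finset.sum_mul_sum]
    refine Finset.sum_congr rfl fun j _ => Finset.sum_congr rfl fun k _ => ?_
    ring
  have hcont := fun i => continuous_unitary_mulVec_apply (ι := ι) v i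
  have hint : ∀ (p j q k : ℕ), MeasureTheory.Integrable (fun U : Matrix.unitaryGroup ι ℂ =>
      ((U : Matrix ι ι ℂ) *ᵥ v) a ^ p * ((U : Matrix ι ι ℂ) *ᵥ v) b ^ j *
        star (((U : Matrix ι ι ℂ) *ᵥ v) a) ^ q * star (((U : Matrix ι ι ℂ) *ᵥ v) b) ^ k)
      (unitaryHaar ι) := fun p j q k =>
    Continuous.integrable_unitaryGroup <|
      ((((hcont a).pow p).mul ((hcont b).pow j)).mul ((hcont a).star.pow q)).mul
        ((hcont b).star.pow k)
  apply Complex.ofReal_injective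
  rw [← integral_complex_ofReal]
  simp only [hexp]
  rw [MeasureTheory.integral_finsetSum _ fun j _ =>
    MeasureTheory.integrable_finsetSum _ fun k _ => (hint _ _ _ _).const_mul _]
  rw [Complex.ofReal_sum]
  refine Finset.sum_congr rfl fun j hj => ?_
  rw [MeasureTheory.integral_finsetSum _ fun k _ => (hint _ _ _ _).const_mul _,
    Finset.sum_eq_single_of_mem j hj]
  · rw [MeasureTheory.integral_const_mul, Complex.ofReal_mul, ← integral_complex_ofReal]
    push_cast
    congr 1
    · ring
    · refine MeasureTheory.integral_congr_ae (.of_forall fun U => ?_)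
      simp only [pow_mul, ← Complex.mul_conj', mul_pow, Complex.star_def]
      ring
  · intro k _ hk
    rw [MeasureTheory.integral_const_mul,
      integral_unitaryHaar_monomial_eq_zero v hab _ _ hk.symm, mul_zero]

/-- Obtained by comparing the coefficients of `s ^ 2` in the moment of order `2 (t + 1)` along
`e_a + s e_b`. -/
theorem integral_unitaryHaar_norm_pow_mul_norm_sq {ι : Type*} [Fintype ι] [DecidableEq ι]
    (v : ι → ℂ) {a b : ι} (hab : a ≠ b) (t : ℕ) :
    ((t : ℝ) + 1) * ∫ U : Matrix.unitaryGroup ι ℂ, ‖((U : Matrix ι ι ℂ) *ᵥ v) a‖ ^ (2 * t) *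
          ‖((U : Matrix ι ι ℂ) *ᵥ v) b‖ ^ 2 ∂unitaryHaar ι =
      ∫ U : Matrix.unitaryGroup ι ℂ, ‖((U : Matrix ι ι ℂ) *ᵥ v) a‖ ^ (2 * (t + 1))
        ∂unitaryHaar ι := by
  set m := ∫ U : Matrix.unitaryGroup ι ℂ, ‖((U : Matrix ι ι ℂ) *ᵥ v) a‖ ^ (2 * (t + 1))
        ∂unitaryHaar ι with hm
  let D : ℕ → ℝ := fun j => ∫ U : Matrix.unitaryGroup ι ℂ,
    ‖((U : Matrix ι ι ℂ) *ᵥ v) a‖ ^ (2 * (t + 1 - j)) *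
          ‖((U : Matrix ι ι ℂ) *ᵥ v) b‖ ^ (2 * j) ∂unitaryHaar ι
  have hpoly : ∑ j ∈ Finset.range (t + 1 + 1),
      Polynomial.monomial j (((t + 1).choose j : ℝ) ^ 2 * D j) =
        Polynomial.C m * (1 + Polynomial.X) ^ (t + 1) := by
    -- as polynomials in `y = s ^ 2`, the two sides agree on all `y ≥ 0`
    refine Polynomial.eq_of_infinite_eval_eq _ _ ((Set.Ici_infinite (0 : ℝ)).mono ?_)
    intro y hy
    have h1 := integral_unitaryHaar_norm_add_pow v hab (t + 1) √y
    have h2 := integral_unitaryHaar_norm_dotProduct_pow v a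
      (Pi.single a 1 + Pi.single b (√y : ℂ)) (t + 1)
    have h3 : ∑ i, ‖(Pi.single a 1 + Pi.single b (√y : ℂ) : ι → ℂ) i‖ ^ 2 = 1 + y := by
      rw [Finset.sum_eq_add_of_mem a b (Finset.mem_univ _) (Finset.mem_univ _) hab]
      · simp [Pi.single_eq_of_ne hab, Pi.single_eq_of_ne hab.symm, Real.sq_sqrt hy]
      · intro i _ hi
        simp [Pi.single_eq_of_ne hi.1, Pi.single_eq_of_ne hi.2]
    rw [h3] at h2
    simp only [add_dotProduct, single_dotProduct, one_mul] at h2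
    rw [h1, Real.sq_sqrt hy] at h2
    simp only [Set.mem_ofPred_eq, Polynomial.eval_finsetSum, Polynomial.eval_monomial,
      Polynomial.eval_mul, Polynomial.eval_C, Polynomial.eval_pow, Polynomial.eval_add,
      Polynomial.eval_one, Polynomial.eval_X]
    rw [mul_comm m, ← h2]
    refine Finset.sum_congr rfl fun j _ => ?_
    simp only [D]
    ring
  have h := congrArg (fun p => Polynomial.coeff p 1) hpoly
  simp only [Polynomial.finsetSum_coeff, Polynomial.coeff_monomial, Polynomial.coeff_C_mul,
    Polynomial.coeff_one_add_X_pow, Finset.sum_ite_eq', Finset.mem_range] at h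
  rw [if_pos (by omega)] at h
  simp only [Nat.choose_one_right, D, Nat.add_sub_cancel, mul_one] at h
  push_cast at h
  have ht : (t : ℝ) + 1 ≠ 0 := by positivity
  apply mul_left_cancel₀ ht
  linear_combination h

/-- Moments of a coordinate of a Haar-random unit vector. -/
theorem prod_mul_integral_unitaryHaar_norm_pow {ι : Type*} [Fintype ι] [DecidableEq ι]
    (v : ι → ℂ) (hv : ∑ i, ‖v i‖ ^ 2 = 1) (a : ι) (t : ℕ) :
    (∏ i ∈ Finset.range t, ((Fintype.card ι : ℝ) + i)) *
      ∫ U : Matrix.unitaryGroup ι ℂ, ‖((U : Matrix ι ι ℂ) *ᵥ v) a‖ ^ (2 * t) ∂unitaryHaar ι =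
      t.factorial := by
  induction t with
  | zero => simp
  | succ t ih =>
    set m' := ∫ U : Matrix.unitaryGroup ι ℂ, ‖((U : Matrix ι ι ℂ) *ᵥ v) a‖ ^ (2 * (t + 1))
        ∂unitaryHaar ι with hm'
    -- insert `1 = ∑ b, |x_b| ^ 2` into the moment of order `t`
    have hsum : ∫ U : Matrix.unitaryGroup ι ℂ, ‖((U : Matrix ι ι ℂ) *ᵥ v) a‖ ^ (2 * t)
          ∂unitaryHaar ι =
        ∑ b, ∫ U : Matrix.unitaryGroup ι ℂ, ‖((U : Matrix ι ι ℂ) *ᵥ v) a‖ ^ (2 * t) *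
          ‖((U : Matrix ι ι ℂ) *ᵥ v) b‖ ^ 2 ∂unitaryHaar ι := by
      rw [← MeasureTheory.integral_finsetSum]
      · simp only [← Finset.mul_sum, sum_norm_sq_unitary_mulVec, hv, mul_one]
      · intro b _
        exact Continuous.integrable_unitaryGroup <|
          ((continuous_unitary_mulVec_apply v a).norm.pow _).mul
            ((continuous_unitary_mulVec_apply v b).norm.pow _)
    have ht : (t : ℝ) + 1 ≠ 0 := by positivity
    have hrec : ((t : ℝ) + 1) * ∫ U : Matrix.unitaryGroup ι ℂ,
        ‖((U : Matrix ι ι ℂ) *ᵥ v) a‖ ^ (2 * t) ∂unitaryHaar ι =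
          ((Fintype.card ι : ℝ) + t) * m' := by
      rw [hsum, ← Finset.add_sum_erase _ _ (Finset.mem_univ a), mul_add, Finset.mul_sum,
        Finset.sum_congr rfl fun b hb => integral_unitaryHaar_norm_pow_mul_norm_sq v
          (Finset.ne_of_mem_erase hb).symm t, ← hm', Finset.sum_const,
        Finset.card_erase_of_mem (Finset.mem_univ a), Finset.card_univ, nsmul_eq_mul,
        Nat.cast_sub (Fintype.card_pos_iff.mpr ⟨a⟩)]
      simp only [← pow_add, hm', mul_add, mul_one]
      push_cast
      ring
    rw [Finset.prod_range_succ, Nat.factorial_succ]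
    push_cast
    rw [← ih]
    linear_combination (-∏ i ∈ Finset.range t, ((Fintype.card ι : ℝ) + i)) * hrec

/-! ### Moments of approximate designs -/

open scoped ComplexOrder in
/-- Completely positive maps are positive, so `⪯` compares diagonal entries of the images of a
positive semidefinite matrix. -/
theorem CPLE.re_apply_apply_le {κ : Type*} [Fintype κ] [DecidableEq κ]
    {A B : Matrix κ κ ℂ →ₗ[ℂ] Matrix κ κ ℂ} (h : CPLE A B) {X : Matrix κ κ ℂ}
    (hX : X.PosSemidef) (i : κ) : (A X i i).re ≤ (B X i i).re := by
  obtain ⟨Φ, hΦ⟩ := h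
  have h0 : (0 : Matrix κ κ ℂ) ≤ X := Matrix.nonneg_iff_posSemidef.mpr hX
  have h1 : (0 : Matrix κ κ ℂ) ≤ Φ X := map_nonneg Φ h0
  have h2 : Φ X = B X - A X := by
    rw [← LinearMap.sub_apply, ← hΦ]; rfl
  rw [h2] at h1
  have h3 := (Matrix.nonneg_iff_posSemidef.mp h1).diag_nonneg (i := i)
  have h4 := (Complex.le_def.mp h3).1
  simpa using h4

theorem momentOperator_apply_apply {ι : Type*} [Fintype ι] [DecidableEq ι] (t : ℕ)
    (μ : MeasureTheory.Measure (Matrix.unitaryGroup ι ℂ)) [MeasureTheory.IsFiniteMeasure μ]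
    (X : Matrix (Fin t → ι) (Fin t → ι) ℂ) (i j : Fin t → ι) :
    momentOperator t μ X i j = ∫ U : Matrix.unitaryGroup ι ℂ,
      (tensorPower t (U : Matrix ι ι ℂ) * X * (tensorPower t (U : Matrix ι ι ℂ))ᴴ) i j ∂μ :=
  ((Matrix.entryLinearMap ℂ ℂ i j).toContinuousLinearMap.integral_comp_comm
    (integrable_tensorPower_conj t μ X)).symm

theorem tensorPower_mulVec {ι : Type*} [Fintype ι] (t : ℕ) (A : Matrix ι ι ℂ) (v : ι → ℂ)
    (i : Fin t → ι) :
    (tensorPower t A *ᵥ fun j => ∏ k, v (j k)) i = ∏ k, (A *ᵥ v) (i k) := by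
  classical
  simp only [Matrix.mulVec, dotProduct, tensorPower, Matrix.of_apply, ← Finset.prod_mul_distrib]
  rw [Finset.prod_univ_sum]
  simp

/-- The diagonal entries of the moment operator at `(|v⟩⟨v|)^{⊗ t}` are moments of coordinates of
`U v`. -/
theorem momentOperator_vecMulVec_apply {ι : Type*} [Fintype ι] [DecidableEq ι] (t : ℕ)
    (μ : MeasureTheory.Measure (Matrix.unitaryGroup ι ℂ)) [MeasureTheory.IsFiniteMeasure μ]
    (v : ι → ℂ) (z : ι) :
    momentOperator t μ (Matrix.vecMulVec (fun j => ∏ k, v (j k))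
      (star fun j => ∏ k, v (j k))) (fun _ => z) (fun _ => z) =
      ((∫ U : Matrix.unitaryGroup ι ℂ, ‖((U : Matrix ι ι ℂ) *ᵥ v) z‖ ^ (2 * t) ∂μ : ℝ) : ℂ) := by
  rw [momentOperator_apply_apply, ← integral_complex_ofReal]
  refine MeasureTheory.integral_congr_ae (.of_forall fun U => ?_)
  simp only [Matrix.mul_vecMulVec, Matrix.vecMulVec_mul, ← Matrix.star_mulVec]
  simp only [Matrix.vecMulVec_apply, tensorPower_mulVec, Pi.star_apply, Finset.prod_const,
    Finset.card_univ, Fintype.card_fin, star_pow, Complex.star_def]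
  rw [← mul_pow, Complex.mul_conj', pow_mul]
  push_cast
  rfl

open scoped ComplexOrder in
theorem IsApproxUnitaryDesign.integral_norm_pow_le {ι : Type*} [Fintype ι] [DecidableEq ι]
    {δ : ℝ} {t : ℕ} {μ : MeasureTheory.Measure (Matrix.unitaryGroup ι ℂ)}
    [MeasureTheory.IsProbabilityMeasure μ] (hμ : IsApproxUnitaryDesign δ t μ) (v : ι → ℂ) (z : ι) :
    ∫ U : Matrix.unitaryGroup ι ℂ, ‖((U : Matrix ι ι ℂ) *ᵥ v) z‖ ^ (2 * t) ∂μ ≤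
      (1 + δ) * ∫ U : Matrix.unitaryGroup ι ℂ, ‖((U : Matrix ι ι ℂ) *ᵥ v) z‖ ^ (2 * t)
        ∂unitaryHaar ι := by
  have h := hμ.2.re_apply_apply_le
    (Matrix.posSemidef_vecMulVec_self_star fun j : Fin t → ι => ∏ k, v (j k)) (fun _ => z)
  rw [LinearMap.smul_apply, Matrix.smul_apply, momentOperator_vecMulVec_apply,
    momentOperator_vecMulVec_apply] at h
  rwa [Complex.smul_re, Complex.ofReal_re, Complex.ofReal_re, smul_eq_mul] at h

/-! ### The quadratic form of the measurement matrix -/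

/-- A function chosen measurably among finitely many continuous functions is integrable. -/
theorem integrable_unitaryGroup_select {ι κ E : Type*} [Fintype ι] [DecidableEq ι] [Fintype κ]
    [MeasurableSpace κ] [MeasurableSingletonClass κ] [NormedAddCommGroup E]
    {μ : MeasureTheory.Measure (Matrix.unitaryGroup ι ℂ)} [MeasureTheory.IsFiniteMeasure μ]
    {g : Matrix.unitaryGroup ι ℂ → κ} (hg : AEMeasurable g μ)
    {F : κ → Matrix.unitaryGroup ι ℂ → E} (hF : ∀ z, Continuous (F z)) :
    MeasureTheory.Integrable (fun U => F (g U) U) μ := by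
  classical
  have h : (fun U => F (g U) U) = fun U => ∑ z, (g ⁻¹' {z}).indicator (F z) U := by
    funext U
    rw [Finset.sum_eq_single_of_mem (g U) (Finset.mem_univ _)]
    · simp
    · intro z _ hz
      simp [hz.symm]
  rw [h]
  exact MeasureTheory.integrable_finsetSum _ fun z _ =>
    (hF z).integrable_unitaryGroup.indicator₀
      (hg.nullMeasurableSet_preimage (measurableSet_singleton z))

/-- The sesquilinear form of `M(g; μ)`. -/
theorem star_dotProduct_measurementMatrix_mulVec {n : ℕ}
    {g : Matrix.unitaryGroup (Fin n → Bool) ℂ → (Fin n → Bool)}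
    {μ : MeasureTheory.Measure (Matrix.unitaryGroup (Fin n → Bool) ℂ)}
    [MeasureTheory.IsFiniteMeasure μ] (hg : AEMeasurable g μ) (w v : (Fin n → Bool) → ℂ) :
    star w ⬝ᵥ (measurementMatrix g μ *ᵥ v) =
      ∫ U : Matrix.unitaryGroup (Fin n → Bool) ℂ,
        star (((U : Matrix (Fin n → Bool) (Fin n → Bool) ℂ) *ᵥ w) (g U)) *
          ((U : Matrix (Fin n → Bool) (Fin n → Bool) ℂ) *ᵥ v) (g U) ∂μ := by
  let L : Matrix (Fin n → Bool) (Fin n → Bool) ℂ →ₗ[ℂ] ℂ :=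
    { toFun := fun M => star w ⬝ᵥ (M *ᵥ v)
      map_add' := fun M N => by rw [Matrix.add_mulVec, dotProduct_add]
      map_smul' := fun c M => by rw [Matrix.smul_mulVec, dotProduct_smul]; rfl }
  have hint := integrable_unitaryGroup_select hg
    (F := fun z (U : Matrix.unitaryGroup (Fin n → Bool) ℂ) =>
      (U : Matrix (Fin n → Bool) (Fin n → Bool) ℂ)ᴴ * Matrix.single z z 1 *
        (U : Matrix (Fin n → Bool) (Fin n → Bool) ℂ))
    fun z => (continuous_subtype_val.matrix_conjTranspose.matrix_mul continuous_const).matrix_mul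
      continuous_subtype_val
  refine (L.toContinuousLinearMap.integral_comp_comm hint).symm.trans ?_
  refine MeasureTheory.integral_congr_ae (.of_forall fun U => ?_)
  change star w ⬝ᵥ ((_ * _ * _) *ᵥ v) = _
  rw [← Matrix.mulVec_mulVec, ← Matrix.mulVec_mulVec, Matrix.dotProduct_mulVec,
    ← Matrix.star_mulVec, Matrix.single_mulVec]
  change _ ⬝ᵥ Pi.single _ _ = _
  rw [dotProduct_single, one_mul]
  rfl

/-- The quadratic form of `M(g; μ)` at a unit vector is controlled by the `t`-th moments, by
Jensen's inequality and the design property. -/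
theorem integral_norm_sq_select_pow_le {n t : ℕ} (ht : 1 ≤ t) {δ : ℝ}
    {μ : MeasureTheory.Measure (Matrix.unitaryGroup (Fin n → Bool) ℂ)}
    [MeasureTheory.IsProbabilityMeasure μ] (hμ : IsApproxUnitaryDesign δ t μ)
    {g : Matrix.unitaryGroup (Fin n → Bool) ℂ → (Fin n → Bool)} (hg : AEMeasurable g μ)
    (v : (Fin n → Bool) → ℂ) (hv : ∑ i, ‖v i‖ ^ 2 = 1) :
    (∫ U : Matrix.unitaryGroup (Fin n → Bool) ℂ,
      ‖((U : Matrix (Fin n → Bool) (Fin n → Bool) ℂ) *ᵥ v) (g U)‖ ^ 2 ∂μ) ^ t ≤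
      (1 + δ) * (t.factorial : ℝ) / ∏ i ∈ Finset.Ico 1 t, ((2 : ℝ) ^ n + (i : ℝ)) := by
  have hcont := fun z => continuous_unitary_mulVec_apply v z
  calc _ ≤ ∫ U : Matrix.unitaryGroup (Fin n → Bool) ℂ,
        (‖((U : Matrix (Fin n → Bool) (Fin n → Bool) ℂ) *ᵥ v) (g U)‖ ^ 2) ^ t ∂μ :=
        (convexOn_pow t).map_integral_le (continuous_pow t).continuousOn isClosed_Ici
          (.of_forall fun U => Set.mem_Ici.mpr (by positivity))
          (integrable_unitaryGroup_select hg fun z => (hcont z).norm.pow 2)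
          (integrable_unitaryGroup_select hg fun z => (continuous_pow t).comp ((hcont z).norm.pow 2))
    _ ≤ ∫ U : Matrix.unitaryGroup (Fin n → Bool) ℂ, ∑ z,
        ‖((U : Matrix (Fin n → Bool) (Fin n → Bool) ℂ) *ᵥ v) z‖ ^ (2 * t) ∂μ := by
        refine MeasureTheory.integral_mono
          (integrable_unitaryGroup_select hg fun z => ((hcont z).norm.pow 2).pow t)
          (Continuous.integrable_unitaryGroup <|
            continuous_finsetSum _ fun z _ => (hcont z).norm.pow _) fun U => ?_
        simp only [← pow_mul]
        exact Finset.single_le_sum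
          (f := fun z => ‖((U : Matrix (Fin n → Bool) (Fin n → Bool) ℂ) *ᵥ v) z‖ ^ (2 * t))
          (fun z _ => by positivity) (Finset.mem_univ (g U))
    _ = ∑ z, ∫ U : Matrix.unitaryGroup (Fin n → Bool) ℂ,
        ‖((U : Matrix (Fin n → Bool) (Fin n → Bool) ℂ) *ᵥ v) z‖ ^ (2 * t) ∂μ :=
        MeasureTheory.integral_finsetSum _ fun z _ =>
          ((hcont z).norm.pow _).integrable_unitaryGroup
    _ ≤ ∑ z : Fin n → Bool, (1 + δ) * ((t.factorial : ℝ) /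
          ∏ i ∈ Finset.range t, ((2 : ℝ) ^ n + (i : ℝ))) := by
        refine Finset.sum_le_sum fun z _ => (hμ.integral_norm_pow_le v z).trans_eq ?_
        have h := prod_mul_integral_unitaryHaar_norm_pow v hv z t
        have hcard : (Fintype.card (Fin n → Bool) : ℝ) = 2 ^ n := by simp
        rw [hcard] at h
        rw [← h, mul_div_cancel_left₀]
        exact Finset.prod_ne_zero_iff.mpr fun i _ => by positivity
    _ = _ := by
        rw [Finset.range_eq_Ico, Finset.prod_eq_prod_Ico_succ_bot ht]
        simp only [Finset.sum_const, Finset.card_univ, Fintype.card_fun, Fintype.card_bool,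
          Fintype.card_fin, nsmul_eq_mul]
        push_cast
        rw [add_zero]
        field_simp

/-! ### The operator norm and the numerical bound -/

theorem norm_toEuclideanCLM_measurementMatrix_le {n : ℕ}
    {μ : MeasureTheory.Measure (Matrix.unitaryGroup (Fin n → Bool) ℂ)}
    [MeasureTheory.IsProbabilityMeasure μ]
    {g : Matrix.unitaryGroup (Fin n → Bool) ℂ → (Fin n → Bool)} (hg : AEMeasurable g μ) {B : ℝ}
    (hB : 0 ≤ B)
    (h : ∀ v : (Fin n → Bool) → ℂ, ∑ i, ‖v i‖ ^ 2 = 1 →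
      ∫ U : Matrix.unitaryGroup (Fin n → Bool) ℂ,
        ‖((U : Matrix (Fin n → Bool) (Fin n → Bool) ℂ) *ᵥ v) (g U)‖ ^ 2 ∂μ ≤ B) :
    ‖Matrix.toEuclideanCLM (𝕜 := ℂ) (measurementMatrix g μ)‖ ≤ B := by
  have hcont := fun (v : (Fin n → Bool) → ℂ) z => continuous_unitary_mulVec_apply v z
  have hunit : ∀ x : EuclideanSpace ℂ (Fin n → Bool), ‖x‖ = 1 → ∑ i, ‖x i‖ ^ 2 = 1 :=
      fun x hx => by
    rw [← EuclideanSpace.norm_sq_eq, hx, one_pow]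
  -- AM-GM bounds the sesquilinear form at unit vectors by the quadratic form
  have key : ∀ x y : EuclideanSpace ℂ (Fin n → Bool), ‖x‖ = 1 → ‖y‖ = 1 →
      ‖inner ℂ y (Matrix.toEuclideanCLM (𝕜 := ℂ) (measurementMatrix g μ) x)‖ ≤ B := by
    intro x y hx hy
    have h1 : inner ℂ y (Matrix.toEuclideanCLM (𝕜 := ℂ) (measurementMatrix g μ) x) =
        star y.ofLp ⬝ᵥ (measurementMatrix g μ *ᵥ x.ofLp) := by
      rw [EuclideanSpace.inner_eq_star_dotProduct, dotProduct_comm]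
      rfl
    rw [h1, star_dotProduct_measurementMatrix_mulVec hg]
    have hi : ∀ w : (Fin n → Bool) → ℂ, MeasureTheory.Integrable
        (fun U : Matrix.unitaryGroup (Fin n → Bool) ℂ =>
        ‖((U : Matrix (Fin n → Bool) (Fin n → Bool) ℂ) *ᵥ w) (g U)‖ ^ 2) μ := fun w =>
      integrable_unitaryGroup_select hg fun z => (hcont w z).norm.pow 2
    refine (MeasureTheory.norm_integral_le_of_norm_le (((hi y).add (hi x)).div_const 2)
      (.of_forall fun U => ?_)).trans ?_
    · rw [norm_mul, norm_star]
      simp only [Pi.add_apply]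
      nlinarith [two_mul_le_add_sq ‖((U : Matrix (Fin n → Bool) (Fin n → Bool) ℂ) *ᵥ y) (g U)‖
        ‖((U : Matrix (Fin n → Bool) (Fin n → Bool) ℂ) *ᵥ x) (g U)‖]
    · rw [MeasureTheory.integral_div]
      simp only [Pi.add_apply]
      rw [MeasureTheory.integral_add (hi y) (hi x)]
      linarith [h _ (hunit x hx), h _ (hunit y hy)]
  refine ContinuousLinearMap.opNorm_le_of_unit_norm hB fun x hx => ?_
  set T := Matrix.toEuclideanCLM (𝕜 := ℂ) (measurementMatrix g μ)
  by_cases hT : T x = 0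
  · simpa [hT] using hB
  -- otherwise, test against the unit vector in the direction of `T x`
  · have hn : ‖T x‖ ≠ 0 := norm_ne_zero_iff.mpr hT
    have h2 := key x ((‖T x‖⁻¹ : ℂ) • T x) hx (by
      rw [norm_smul, norm_inv, Complex.norm_real, norm_norm, inv_mul_cancel₀ hn])
    rw [inner_smul_left, inner_self_eq_norm_sq_to_K, norm_mul] at h2
    simpa [pow_two, ← mul_assoc, hn] using h2

/-- Bernoulli's inequality combined with `t! ≤ t ^ t`. -/
theorem one_add_mul_factorial_le_pow {δ : ℝ} (hδ : 0 ≤ 1 + δ) {t : ℕ} (ht : 1 ≤ t) :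
    (1 + δ) * (t.factorial : ℝ) ≤ (δ + t) ^ t := by
  have ht0 : (0 : ℝ) < t := by exact_mod_cast ht
  have ht1 : (1 : ℝ) ≤ t := by exact_mod_cast ht
  have h1 : 1 + (t : ℝ) * (δ / t) ≤ (1 + δ / t) ^ t :=
    one_add_mul_le_pow (by rw [le_div_iff₀ ht0]; linarith) t
  rw [mul_div_cancel₀ _ ht0.ne'] at h1
  calc (1 + δ) * (t.factorial : ℝ) ≤ (1 + δ / t) ^ t * (t : ℝ) ^ t :=
        mul_le_mul h1 (by exact_mod_cast Nat.factorial_le_pow t) (by positivity)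
          (hδ.trans h1)
    _ = (δ + t) ^ t := by
        rw [← mul_pow]
        congr 1
        field_simp
        ring

theorem pow_le_prod_Ico_add (n : ℕ) {t : ℕ} :
    ((2 : ℝ) ^ n) ^ (t - 1) ≤ ∏ i ∈ Finset.Ico 1 t, ((2 : ℝ) ^ n + (i : ℝ)) := by
  calc ((2 : ℝ) ^ n) ^ (t - 1) = ∏ i ∈ Finset.Ico 1 t, (2 : ℝ) ^ n := by simp
    _ ≤ _ := Finset.prod_le_prod (fun i _ => by positivity) fun i _ => by
        linarith [Nat.cast_nonneg (α := ℝ) i]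

theorem mainTheorem8 (n t : ℕ) (ht : 1 ≤ t) (δ : ℝ)
    (μ : MeasureTheory.Measure (Matrix.unitaryGroup (Fin n → Bool) ℂ))
    [MeasureTheory.IsProbabilityMeasure μ]
    (hμ : IsApproxUnitaryDesign δ t μ)
    (g : Matrix.unitaryGroup (Fin n → Bool) ℂ → (Fin n → Bool))
    (hg : AEMeasurable g μ) :
    ‖Matrix.toEuclideanCLM (𝕜 := ℂ) (measurementMatrix g μ)‖ ≤
        ((1 + δ) * (t.factorial : ℝ) / ∏ i ∈ Finset.Ico 1 t, ((2 : ℝ) ^ n + (i : ℝ))) ^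
          (1 / (t : ℝ)) ∧
      ((1 + δ) * (t.factorial : ℝ) / ∏ i ∈ Finset.Ico 1 t, ((2 : ℝ) ^ n + (i : ℝ))) ^
          (1 / (t : ℝ)) ≤
        (δ + (t : ℝ)) / (2 : ℝ) ^ ((n : ℝ) * ((t : ℝ) - 1) / (t : ℝ)) := by
  have ht0 : t ≠ 0 := Nat.one_le_iff_ne_zero.mp ht
  have htR : (t : ℝ) ≠ 0 := Nat.cast_ne_zero.mpr ht0
  have ht1 : (1 : ℝ) ≤ t := by exact_mod_cast ht
  set P := ∏ i ∈ Finset.Ico 1 t, ((2 : ℝ) ^ n + (i : ℝ)) with hP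
  have hP0 : 0 < P := Finset.prod_pos fun i _ => by positivity
  have hform := fun v hv => integral_norm_sq_select_pow_le ht hμ hg v hv
  -- the bound itself shows that `1 + δ` is nonnegative, so that its real power is meaningful
  have hδ : 0 ≤ 1 + δ := by
    have h := hform (Pi.single 0 1) (by
      rw [Finset.sum_eq_single_of_mem 0 (Finset.mem_univ _)]
      · simp
      · intro i _ hi
        simp [Pi.single_eq_of_ne hi])
    have h2 := (pow_nonneg (MeasureTheory.integral_nonneg fun U => by positivity) t).trans h
    rw [← hP, mul_div_assoc] at h2
    exact nonneg_of_mul_nonneg_left h2 (by positivity)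
  have hQ : 0 ≤ (1 + δ) * (t.factorial : ℝ) / P := by positivity
  refine ⟨norm_toEuclideanCLM_measurementMatrix_le hg (Real.rpow_nonneg hQ _) fun v hv => ?_, ?_⟩
  · have h0 := MeasureTheory.integral_nonneg (μ := μ)
      (f := fun U : Matrix.unitaryGroup (Fin n → Bool) ℂ =>
        ‖((U : Matrix (Fin n → Bool) (Fin n → Bool) ℂ) *ᵥ v) (g U)‖ ^ 2)
      fun U => by positivity
    rw [one_div, ← Real.pow_rpow_inv_natCast h0 ht0]
    exact Real.rpow_le_rpow (pow_nonneg h0 t) (hform v hv) (by positivity)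
  · have h0 : 0 ≤ (δ + t) / (2 : ℝ) ^ ((n : ℝ) * ((t : ℝ) - 1) / (t : ℝ)) :=
      div_nonneg (by linarith) (by positivity)
    rw [one_div, ← Real.pow_rpow_inv_natCast h0 ht0]
    refine Real.rpow_le_rpow hQ ?_ (by positivity)
    have h2 : ((2 : ℝ) ^ ((n : ℝ) * ((t : ℝ) - 1) / (t : ℝ))) ^ t = ((2 : ℝ) ^ n) ^ (t - 1) := by
      rw [← Real.rpow_natCast, ← Real.rpow_mul (by norm_num), div_mul_cancel₀ _ htR,
        ← pow_mul, ← Real.rpow_natCast]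
      congr 1
      push_cast [Nat.cast_sub ht]
      ring
    rw [div_pow, h2]
    exact div_le_div₀ (pow_nonneg (by linarith) t) (one_add_mul_factorial_le_pow hδ ht)
      (by positivity) (pow_le_prod_Ico_add n)
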